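/- Let $G$ be a finite non-empty graph (parallel edges and loops allowed, connectedness not required) that is cubic (every vertex has degree $3$, a loop counting twice), bridgeless (no edge is such that its deletion separates its two ends) and planar (it can be drawn in $\mathbb{R}^2$ without crossings, the edges being simple polygonal curves). Then the girth of $G$, i.e. the length of a shortest cycle, is at most $5$; here a loop is a cycle of length $1$ and two parallel edges form a cycle of length $2$. Moreover, in every such drawing of $G$ there is a face (a connected component of the complement of the drawing) that has at most $5$ edges on its boundary, and among these boundary edges there are the edges of a cycle of $G$, which therefore has length at most $5$. -/

import Mathlib

open Set
open scoped Graph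

/-! ### Multigraphs: cubic, bridgeless, cycles, girth

Graphs are Mathlib's multigraphs `Graph α β`; parallel edges and loops are allowed. -/

namespace Graph

variable {α β : Type*}

/-- A graph is cubic if every vertex has degree three, a loop counting twice. -/
def IsCubic (G : Graph α β) : Prop :=
  ∀ x ∈ V(G), (G.incidenceSet x).encard + (G.loopSet x).encard = 3

/-- An edge is a bridge if, after it is deleted, no walk joins its two ends. -/
def IsBridge (G : Graph α β) (e : β) : Prop :=
  ∃ x y, G.IsLink e x y ∧ ¬ Relation.ReflTransGen (G.deleteEdges {e}).Adj x y

/-- A graph is bridgeless if none of its edges is a bridge. -/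
def IsBridgeless (G : Graph α β) : Prop :=
  ∀ e, ¬ G.IsBridge e

/-- A cycle of length `n ≥ 1`: distinct vertices `v 0, …, v (n - 1)` and distinct edges
`e 0, …, e (n - 1)`, where `e i` joins `v i` to its cyclic successor. A loop is a cycle of
length one, two parallel edges form a cycle of length two. -/
structure IsCycle (G : Graph α β) (n : ℕ) (v : Fin n → α) (e : Fin n → β) : Prop where
  pos : 0 < n
  vertex_injective : Function.Injective v
  edge_injective : Function.Injective e
  isLink : ∀ i, G.IsLink (e i) (v i) (v (finRotate n i))

/-- The girth: the length of a shortest cycle, `⊤` if there is no cycle. -/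
noncomputable def egirth (G : Graph α β) : ℕ∞ :=
  ⨅ (n : ℕ) (_ : ∃ v e, G.IsCycle n v e), (n : ℕ∞)

/-! ### Drawings in the plane -/

/-- The polygonal curve through the points `p 0, p 1, p 2, …`: for a natural number `i` and
`s ∈ [0, 1)`, at time `i + s` it is at `(1 - s) • p i + s • p (i + 1)`. -/
noncomputable def polygonalCurve (p : ℕ → ℝ × ℝ) (t : ℝ) : ℝ × ℝ :=
  AffineMap.lineMap (p ⌊t⌋₊) (p (⌊t⌋₊ + 1)) (Int.fract t)

/-- A drawing of `G` in the plane without crossings. Distinct vertices are distinct points;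
every edge is a polygonal curve of finitely many segments between its ends, without
self-intersections; the interior of an edge contains no vertex and no point of another edge.
(The curve of a loop is closed.) -/
structure PlaneDrawing (G : Graph α β) where
  /-- The position of a vertex. -/
  point : α → ℝ × ℝ
  /-- The number of segments of an edge. -/
  segments : β → ℕ
  /-- The successive corners of an edge; those numbered `0, …, segments e` are relevant. -/
  corner : β → ℕ → ℝ × ℝ
  point_injOn : InjOn point V(G)
  segments_pos : ∀ e ∈ E(G), 0 < segments e
  ends : ∀ e ∈ E(G), ∃ x y, G.IsLink e x y ∧
    corner e 0 = point x ∧ corner e (segments e) = point y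
  curve_injOn : ∀ e ∈ E(G), InjOn (polygonalCurve (corner e)) (Ioo 0 (segments e : ℝ))
  vertex_notMem : ∀ e ∈ E(G), ∀ x ∈ V(G),
    point x ∉ polygonalCurve (corner e) '' Ioo 0 (segments e : ℝ)
  edge_disjoint : ∀ e ∈ E(G), ∀ f ∈ E(G), e ≠ f →
    Disjoint (polygonalCurve (corner e) '' Ioo 0 (segments e : ℝ))
      (polygonalCurve (corner f) '' Ioo 0 (segments f : ℝ))

/-- A graph is planar if it can be drawn in the plane without crossings. -/
def IsPlanar (G : Graph α β) : Prop := Nonempty G.PlaneDrawing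

namespace PlaneDrawing

variable {G : Graph α β} (D : G.PlaneDrawing)

/-- The set of points of an edge, end points included. -/
def arc (e : β) : Set (ℝ × ℝ) :=
  polygonalCurve (D.corner e) '' Icc 0 (D.segments e : ℝ)

/-- The set of points of the drawing. -/
def support : Set (ℝ × ℝ) :=
  D.point '' V(G) ∪ ⋃ e ∈ E(G), D.arc e

/-- The faces: the connected components of the complement of the drawing. -/
def faces : Set (Set (ℝ × ℝ)) :=
  {F | ∃ z ∈ D.supportᶜ, F = connectedComponentIn D.supportᶜ z}

/-- The edges that surround a face: those that lie on its boundary. -/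
def boundaryEdges (F : Set (ℝ × ℝ)) : Set β :=
  {e ∈ E(G) | D.arc e ⊆ frontier F}

end PlaneDrawing

end Graph

/-! Let v, e, f count vertices, edges and faces. If every face had at least six boundary edges, then
6f ≤ 2e, since an edge bounds at most two faces (`six_mul_card_le`). Degree three gives 3v ≤ 2e
(`IsCubic.three_mul_ncard_le`). Together f + v ≤ e, against the inequality e < f + v. This half of
Euler's formula suffices, and it holds for disconnected graphs too.

Euler's inequality (`ncard_edgeSet_lt_ncard_faces_add`) comes from winding numbers. The complex
cycle space has dimension at least e - v. A weighted cycle has a winding function, a sum of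
logarithms, which is constant on each face and jumps by 2πi times the weight across each segment.
Hence the cycle space together with the constants embeds in the functions on the faces, so e - v + 1
≤ f.

For the cycle, e < f + v also excludes a single face. So a small face F and the union O of the other
faces are both nonempty, and some segment lies in closure F ∩ closure O (`exists_seg_subset`). Such
separation spreads along a segment and continues into another segment at each end
(`exists_ne_seg_subset`). The edges separating F from O thus form a nonempty set without dead ends,
which contains a cycle. -/

/-- An indexed family of nondegenerate segments in the plane, the interior of each
being disjoint from all the other (closed) segments. -/
structure SegmentDrawing (ι : Type*) where
  /-- The first end of a segment. -/
  src : ι → ℝ × ℝ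
  /-- The second end of a segment. -/
  tgt : ι → ℝ × ℝ
  ne : ∀ i, src i ≠ tgt i
  disj : ∀ i j, i ≠ j → Disjoint (openSegment ℝ (src i) (tgt i)) (segment ℝ (src j) (tgt j))

/-! ### Local structure of the complement near a segment -/

namespace SegmentDrawing

variable {ι : Type*} (S : SegmentDrawing ι)

/-- The closed segment with index `i`. -/
def seg (i : ι) : Set (ℝ × ℝ) := segment ℝ (S.src i) (S.tgt i)

/-- The open segment with index `i`. -/
def openSeg (i : ι) : Set (ℝ × ℝ) := openSegment ℝ (S.src i) (S.tgt i)

/-- The set of points of all the segments. -/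
def support : Set (ℝ × ℝ) := ⋃ i, S.seg i

lemma openSeg_subset_seg (i : ι) : S.openSeg i ⊆ S.seg i := openSegment_subset_segment _ _ _

lemma seg_subset_support (i : ι) : S.seg i ⊆ S.support := subset_iUnion S.seg i

lemma isClosed_seg (i : ι) : IsClosed (S.seg i) := by
  have : IsCompact (S.seg i) := by
    rw [seg, segment_eq_image_lineMap]
    exact isCompact_Icc.image (AffineMap.lineMap_continuous)
  exact this.isClosed

lemma isClosed_support [Finite ι] : IsClosed S.support :=
  isClosed_iUnion_of_finite S.isClosed_seg

lemma seg_subset_closure_openSeg (i : ι) : S.seg i ⊆ closure (S.openSeg i) :=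
  segment_subset_closure_openSegment

/-- The linear form vanishing exactly on the direction of the segment `i`. -/
def side (i : ι) (q : ℝ × ℝ) : ℝ :=
  ((S.tgt i).1 - (S.src i).1) * (q.2 - (S.src i).2) -
    ((S.tgt i).2 - (S.src i).2) * (q.1 - (S.src i).1)

/-- A normal vector of the segment `i`. -/
def normal (i : ι) : ℝ × ℝ :=
  (-((S.tgt i).2 - (S.src i).2), (S.tgt i).1 - (S.src i).1)

lemma normSq_pos (i : ι) :
    0 < ((S.tgt i).1 - (S.src i).1) ^ 2 + ((S.tgt i).2 - (S.src i).2) ^ 2 := by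
  have h := S.ne i
  by_contra! h0
  refine h (Prod.ext ?_ ?_) <;> nlinarith [sq_nonneg ((S.tgt i).1 - (S.src i).1),
    sq_nonneg ((S.tgt i).2 - (S.src i).2)]

lemma side_add_normal (i : ι) (q : ℝ × ℝ) (t : ℝ) :
    S.side i (q + t • S.normal i) = S.side i q +
      t * (((S.tgt i).1 - (S.src i).1) ^ 2 + ((S.tgt i).2 - (S.src i).2) ^ 2) := by
  simp [side, normal]; ring

lemma side_eq_zero_iff (i : ι) (q : ℝ × ℝ) :
    S.side i q = 0 ↔ ∃ t : ℝ, q = AffineMap.lineMap (S.src i) (S.tgt i) t := by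
  have hp := S.normSq_pos i
  constructor
  · intro h
    set a := S.src i
    set b := S.tgt i
    refine ⟨((b.1 - a.1) * (q.1 - a.1) + (b.2 - a.2) * (q.2 - a.2)) /
      ((b.1 - a.1) ^ 2 + (b.2 - a.2) ^ 2), ?_⟩
    have h' : (b.1 - a.1) * (q.2 - a.2) - (b.2 - a.2) * (q.1 - a.1) = 0 := h
    ext
    · simp only [AffineMap.lineMap_apply, Prod.fst_add, Prod.smul_fst, vsub_eq_sub, vadd_eq_add,
        Prod.fst_sub, smul_eq_mul]
      field_simp
      linear_combination (-(b.2 - a.2)) * h'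
    · simp only [AffineMap.lineMap_apply, Prod.snd_add, Prod.smul_snd, vsub_eq_sub, vadd_eq_add,
        Prod.snd_sub, smul_eq_mul]
      field_simp
      linear_combination (b.1 - a.1) * h'
  · rintro ⟨t, rfl⟩
    simp [side, AffineMap.lineMap_apply]; ring

/-- Around an interior point of a segment, a small ball meets the drawing in that segment only,
which is a full chord of the ball. -/
lemma exists_ball_inter_support [Finite ι] {i : ι} {p : ℝ × ℝ} (hp : p ∈ S.openSeg i) :
    ∃ r > 0, ∀ q ∈ Metric.ball p r, (q ∈ S.support ↔ S.side i q = 0) ∧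
      (S.side i q = 0 → q ∈ S.openSeg i) := by
  -- The ball must also avoid the two ends of segment `i`, so that the segment crosses it
  -- completely.
  have hcl : IsClosed ((⋃ j : {j // j ≠ i}, S.seg j) ∪ {S.src i, S.tgt i}) :=
    (isClosed_iUnion_of_finite fun j : {j // j ≠ i} => S.isClosed_seg j).union
      (Set.toFinite _).isClosed
  have hpn : p ∉ (⋃ j : {j // j ≠ i}, S.seg j) ∪ {S.src i, S.tgt i} := by
    rintro (h | h)
    · obtain ⟨⟨j, hj⟩, h⟩ := mem_iUnion.1 h
      exact disjoint_left.1 (S.disj i j hj.symm) hp h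
    · rcases h with rfl | h
      · exact S.ne i (left_mem_openSegment_iff.1 hp)
      · rw [mem_singleton_iff.1 h] at hp
        exact S.ne i (right_mem_openSegment_iff.1 hp)
  obtain ⟨r, hr, hball⟩ := Metric.isOpen_iff.1 hcl.isOpen_compl p hpn
  refine ⟨r, hr, fun q hq => ?_⟩
  have key : S.side i q = 0 → q ∈ S.openSeg i := by
    intro h
    obtain ⟨t, ht⟩ := (S.side_eq_zero_iff i q).1 h
    have hconv : ∀ x ∈ segment ℝ p q, x ∉ ({S.src i, S.tgt i} : Set (ℝ × ℝ)) := fun x hx hx' =>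
      hball ((convex_ball p r).segment_subset (Metric.mem_ball_self hr) hq hx) (Or.inr hx')
    rw [openSeg, openSegment_eq_image_lineMap] at hp ⊢
    obtain ⟨s, ⟨hs0, hs1⟩, rfl⟩ := hp
    refine ⟨t, ⟨?_, ?_⟩, ht.symm⟩
    -- If the parameter `t` of `q` were at most 0, the end `S.src i` would lie between `q` and `p`,
    -- hence in the ball.
    · by_contra! h0
      refine hconv (S.src i) ?_ (Or.inl rfl)
      rw [ht, ← image_segment, segment_symm, segment_eq_Icc (by linarith)]
      exact ⟨0, ⟨h0, hs0.le⟩, by simp⟩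
    · by_contra! h0
      refine hconv (S.tgt i) ?_ (Or.inr rfl)
      rw [ht, ← image_segment, segment_eq_Icc (by linarith)]
      exact ⟨1, ⟨hs1.le, h0⟩, by simp⟩
  refine ⟨⟨fun h => ?_, fun h => S.seg_subset_support i (S.openSeg_subset_seg i (key h))⟩, key⟩
  obtain ⟨j, hj⟩ := mem_iUnion.1 h
  by_cases hji : j = i
  · subst hji
    rw [seg, segment_eq_image_lineMap] at hj
    obtain ⟨t, -, rfl⟩ := hj
    exact (S.side_eq_zero_iff j _).2 ⟨t, rfl⟩
  · exact absurd (Or.inl (mem_iUnion.2 ⟨⟨j, hji⟩, hj⟩)) (hball hq)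

lemma convex_side_pos (i : ι) : Convex ℝ {q | 0 < S.side i q} := by
  intro x hx y hy a b ha hb hab
  have : S.side i (a • x + b • y) = a * S.side i x + b * S.side i y := by
    obtain rfl : a = 1 - b := by linarith
    simp [side]; ring
  simp only [mem_ofPred_eq] at hx hy ⊢
  rw [this]
  rcases ha.eq_or_lt with rfl | ha
  · obtain rfl : b = 1 := by linarith
    simpa using hy
  · nlinarith [mul_pos ha hx, mul_nonneg hb hy.le]

lemma convex_side_neg (i : ι) : Convex ℝ {q | S.side i q < 0} := by
  intro x hx y hy a b ha hb hab
  have : S.side i (a • x + b • y) = a * S.side i x + b * S.side i y := by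
    obtain rfl : a = 1 - b := by linarith
    simp [side]; ring
  simp only [mem_ofPred_eq] at hx hy ⊢
  rw [this]
  rcases ha.eq_or_lt with rfl | ha
  · obtain rfl : b = 1 := by linarith
    simpa using hy
  · nlinarith [mul_pos ha (neg_pos.2 hx), mul_nonneg hb (neg_pos.2 hy).le]

lemma tendsto_add_normal (i : ι) (q : ℝ × ℝ) {f : Filter ℝ} (hf : f ≤ nhds 0) :
    Filter.Tendsto (fun t : ℝ => q + t • S.normal i) f (nhds q) := by
  have : Continuous fun t : ℝ => q + t • S.normal i := by fun_prop
  simpa using (this.tendsto 0).mono_left hf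

/-- Around an interior point of a segment, the complement of the drawing consists of two
connected sides, each of which has the segment in its closure. -/
lemma exists_two_sides [Finite ι] {i : ι} {p : ℝ × ℝ} (hp : p ∈ S.openSeg i) :
    ∃ U H₁ H₂ : Set (ℝ × ℝ), IsOpen U ∧ p ∈ U ∧ IsPreconnected H₁ ∧ IsPreconnected H₂ ∧
      H₁ ⊆ S.supportᶜ ∧ H₂ ⊆ S.supportᶜ ∧ U \ S.support ⊆ H₁ ∪ H₂ ∧
      U ∩ S.support ⊆ closure H₁ ∩ closure H₂ ∧ U ∩ S.support ⊆ S.openSeg i := by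
  obtain ⟨r, hr, h⟩ := S.exists_ball_inter_support hp
  have hn := S.normSq_pos i
  refine ⟨Metric.ball p r, Metric.ball p r ∩ {q | 0 < S.side i q},
    Metric.ball p r ∩ {q | S.side i q < 0}, Metric.isOpen_ball, Metric.mem_ball_self hr,
    ((convex_ball p r).inter (S.convex_side_pos i)).isPreconnected,
    ((convex_ball p r).inter (S.convex_side_neg i)).isPreconnected, ?_, ?_, ?_, ?_, ?_⟩
  · rintro q ⟨hq, hq'⟩ hs
    exact hq'.ne' ((h q hq).1.1 hs)
  · rintro q ⟨hq, hq'⟩ hs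
    exact hq'.ne ((h q hq).1.1 hs)
  · rintro q ⟨hq, hs⟩
    rcases lt_trichotomy (S.side i q) 0 with h' | h' | h'
    · exact Or.inr ⟨hq, h'⟩
    · exact absurd ((h q hq).1.2 h') hs
    · exact Or.inl ⟨hq, h'⟩
  · rintro q ⟨hq, hs⟩
    have h0 := (h q hq).1.1 hs
    constructor
    · refine mem_closure_of_tendsto (S.tendsto_add_normal i q
        (f := nhdsWithin 0 (Ioi 0)) inf_le_left) ?_
      filter_upwards [(S.tendsto_add_normal i q (f := nhdsWithin 0 (Ioi 0)) inf_le_left).eventually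
        (Metric.isOpen_ball.mem_nhds hq), self_mem_nhdsWithin] with t ht ht'
      refine ⟨ht, ?_⟩
      simp only [mem_ofPred_eq, side_add_normal, h0, zero_add]
      exact mul_pos ht' hn
    · refine mem_closure_of_tendsto (S.tendsto_add_normal i q
        (f := nhdsWithin 0 (Iio 0)) inf_le_left) ?_
      filter_upwards [(S.tendsto_add_normal i q (f := nhdsWithin 0 (Iio 0)) inf_le_left).eventually
        (Metric.isOpen_ball.mem_nhds hq), self_mem_nhdsWithin] with t ht ht'
      refine ⟨ht, ?_⟩
      simp only [mem_ofPred_eq, side_add_normal, h0, zero_add]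
      exact mul_neg_of_neg_of_pos ht' hn
  · rintro q ⟨hq, hs⟩
    exact (h q hq).2 ((h q hq).1.1 hs)

lemma dense_compl_support [Finite ι] : Dense S.supportᶜ := by
  intro p
  by_cases hp : p ∈ S.support
  · obtain ⟨i, hi⟩ := mem_iUnion.1 hp
    refine closure_minimal (fun q hq => ?_) isClosed_closure (S.seg_subset_closure_openSeg i hi)
    obtain ⟨U, H₁, H₂, -, hqU, -, -, hs₁, -, -, hcl, -⟩ := S.exists_two_sides hq
    exact closure_mono hs₁ (hcl ⟨hqU, S.seg_subset_support i (S.openSeg_subset_seg i hq)⟩).1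
  · exact subset_closure hp

/-! ### Segments separating two open parts of the complement -/

section Separation

variable {F O : Set (ℝ × ℝ)}

lemma closure_union_closure_eq_univ [Finite ι] (hu : F ∪ O = S.supportᶜ) :
    closure F ∪ closure O = univ := by
  rw [← closure_union, hu]
  exact S.dense_compl_support.closure_eq

lemma isPreconnected_openSeg (i : ι) : IsPreconnected (S.openSeg i) :=
  (convex_openSegment _ _).isPreconnected

lemma closure_inter_closure_subset_support (hF : IsOpen F) (hO : IsOpen O) (hd : Disjoint F O)
    (hu : F ∪ O = S.supportᶜ) : closure F ∩ closure O ⊆ S.support := by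
  rintro p ⟨hpF, hpO⟩
  by_contra hp
  rcases hu.ge hp with h | h
  · exact disjoint_left.1 (hd.closure_right hF) h hpO
  · exact disjoint_left.1 (hd.closure_left hO) hpF h

/-- If a segment separates `F` from `O` at an interior point, it does so everywhere. -/
lemma seg_subset_closure_inter_closure [Finite ι] (hF : IsOpen F) (hO : IsOpen O)
    (hd : Disjoint F O) (hu : F ∪ O = S.supportᶜ) {i : ι}
    (h : (S.openSeg i ∩ (closure F ∩ closure O)).Nonempty) :
    S.seg i ⊆ closure F ∩ closure O := by
  have hJ : IsClosed (closure F ∩ closure O) := isClosed_closure.inter isClosed_closure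
  suffices S.openSeg i ⊆ closure F ∩ closure O from
    (S.seg_subset_closure_openSeg i).trans (closure_minimal this hJ)
  -- The closed set `closure F ∩ closure O` is also relatively open in the open segment, which is
  -- connected.
  have key : ∀ p ∈ S.openSeg i, p ∈ closure F ∩ closure O →
      ∃ U, IsOpen U ∧ p ∈ U ∧ U ∩ S.support ⊆ closure F ∩ closure O := by
    intro p hp hpJ
    obtain ⟨U, H₁, H₂, hU, hpU, h₁, h₂, hs₁, hs₂, hcov, hcl, -⟩ := S.exists_two_sides hp
    refine ⟨U, hU, hpU, hcl.trans ?_⟩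
    have meet : ∀ X : Set (ℝ × ℝ), X ⊆ S.supportᶜ → p ∈ closure X →
        (X ∩ H₁).Nonempty ∨ (X ∩ H₂).Nonempty := by
      intro X hX hpX
      obtain ⟨q, hqU, hqX⟩ := mem_closure_iff.1 hpX U hU hpU
      rcases hcov ⟨hqU, hX hqX⟩ with hq | hq
      · exact Or.inl ⟨q, hqX, hq⟩
      · exact Or.inr ⟨q, hqX, hq⟩
    have dich : ∀ H : Set (ℝ × ℝ), IsPreconnected H → H ⊆ S.supportᶜ → H ⊆ F ∨ H ⊆ O :=
      fun H hH hHs => hH.subset_or_subset hF hO hd (hHs.trans hu.ge)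
    have hmF := meet F (subset_union_left.trans hu.le) hpJ.1
    have hmO := meet O (subset_union_right.trans hu.le) hpJ.2
    have no : ∀ {H A B : Set (ℝ × ℝ)}, Disjoint A B → H ⊆ A → ¬ (B ∩ H).Nonempty :=
      fun hAB hHA ⟨q, hqB, hqH⟩ => disjoint_left.1 hAB (hHA hqH) hqB
    -- Both `F` and `O` accumulate at `p`, so one side of the segment lies in `F` and the other in
    -- `O`.
    rcases dich H₁ h₁ hs₁ with k₁ | k₁ <;> rcases dich H₂ h₂ hs₂ with k₂ | k₂
    · exact absurd hmO (not_or.2 ⟨no hd k₁, no hd k₂⟩)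
    · exact inter_subset_inter (closure_mono k₁) (closure_mono k₂)
    · exact fun q hq => ⟨closure_mono k₂ hq.2, closure_mono k₁ hq.1⟩
    · exact absurd hmF (not_or.2 ⟨no hd.symm k₁, no hd.symm k₂⟩)
  by_contra hnot
  obtain ⟨q, hq, hqJ⟩ := not_subset.1 hnot
  let V : Set (ℝ × ℝ) := ⋃₀ {U | IsOpen U ∧ U ∩ S.support ⊆ closure F ∩ closure O}
  have hV : IsOpen V := isOpen_sUnion fun U hU => hU.1
  obtain ⟨p, hp, hpJ⟩ := h
  obtain ⟨x, hx, hxV, hxJ⟩ := S.isPreconnected_openSeg i V (closure F ∩ closure O)ᶜ hV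
    hJ.isOpen_compl (fun x hx => by
      by_cases hxJ : x ∈ closure F ∩ closure O
      · obtain ⟨U, hU, hxU, hUs⟩ := key x hx hxJ
        exact Or.inl ⟨U, ⟨hU, hUs⟩, hxU⟩
      · exact Or.inr hxJ)
    (by obtain ⟨U, hU, hpU, hUs⟩ := key p hp hpJ
        exact ⟨p, hp, U, ⟨hU, hUs⟩, hpU⟩) ⟨q, hq, hqJ⟩
  obtain ⟨U, ⟨-, hUs⟩, hxU⟩ := hxV
  exact hxJ (hUs ⟨hxU, S.seg_subset_support i (S.openSeg_subset_seg i hx)⟩)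

end Separation

/-- A ball minus a closed radius is connected. -/
lemma _root_.isPreconnected_ball_diff_segment {E : Type*} [NormedAddCommGroup E] [NormedSpace ℝ E]
    {p p' : E} {r : ℝ} (hr : 0 < r) (hp' : p' ∉ Metric.ball p r) :
    IsPreconnected (Metric.ball p r \ segment ℝ p p') := by
  have hd : p' - p ≠ 0 := fun h => hp' (by rw [sub_eq_zero.1 h]; exact Metric.mem_ball_self hr)
  have hn : 0 < ‖p' - p‖ := norm_pos_iff.2 hd
  have hrn : r ≤ ‖p' - p‖ := by
    simpa [dist_eq_norm] using hp'
  -- The set is star-shaped about the point at distance `r / 2` from `p`, opposite to the removed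
  -- radius.
  set ε : ℝ := r / (2 * ‖p' - p‖) with hε
  have hε0 : 0 < ε := by positivity
  have hinj : ∀ s t : ℝ, s • (p' - p) = t • (p' - p) → s = t := fun s t h =>
    smul_left_injective ℝ hd h
  have hseg : ∀ x, x ∈ segment ℝ p p' ↔ ∃ t ∈ Icc (0 : ℝ) 1, x = p + t • (p' - p) := by
    intro x
    rw [segment_eq_image']
    simp [eq_comm]
  have hc : p - ε • (p' - p) ∈ Metric.ball p r \ segment ℝ p p' := by
    constructor
    · rw [Metric.mem_ball, dist_eq_norm]
      simp only [sub_sub_cancel_left, norm_neg, norm_smul, Real.norm_eq_abs, abs_of_pos hε0]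
      rw [hε]; field_simp; linarith
    · rw [hseg]
      rintro ⟨t, ht, h⟩
      have := hinj (-ε) t (by linear_combination (norm := module) h)
      linarith [ht.1]
  have hstar : StarConvex ℝ (p - ε • (p' - p)) (Metric.ball p r \ segment ℝ p p') := by
    intro q hq a b ha hb hab
    refine ⟨(convex_ball p r) hc.1 hq.1 ha hb hab, fun hmem => ?_⟩
    obtain ⟨t, ht, h⟩ := (hseg _).1 hmem
    rcases hb.eq_or_lt with rfl | hb
    · obtain rfl : a = 1 := by linarith
      exact hc.2 (by simpa using hmem)
    -- If the path from the centre to `q` meets the radius, then `q` is on the ray from `p` through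
    -- `p'`; being in the ball, it is on the radius itself.
    · have hqe : q = p + ((t + a * ε) / b) • (p' - p) := by
        have : b • q = b • p + (t + a * ε) • (p' - p) := by
          obtain rfl : a = 1 - b := by linarith
          linear_combination (norm := module) h
        rw [← inv_smul_smul₀ hb.ne' q, this, smul_add, inv_smul_smul₀ hb.ne', smul_smul,
          inv_mul_eq_div]
      have hτ : 0 ≤ (t + a * ε) / b := by have := ht.1; positivity
      refine hq.2 ((hseg q).2 ⟨_, ⟨hτ, ?_⟩, hqe⟩)
      have hqb := hq.1
      rw [hqe, Metric.mem_ball, dist_eq_norm, add_sub_cancel_left, norm_smul, Real.norm_eq_abs,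
        abs_of_nonneg hτ] at hqb
      by_contra! h1
      nlinarith
  exact (hstar.isPathConnected hc).isConnected.isPreconnected

/-- If a segment separates `F` from `O`, then so does another one at each of its ends. -/
lemma exists_ne_seg_subset [Finite ι] {F O : Set (ℝ × ℝ)} (hF : IsOpen F) (hO : IsOpen O)
    (hd : Disjoint F O) (hu : F ∪ O = S.supportᶜ) {i : ι}
    (hi : S.seg i ⊆ closure F ∩ closure O) {p : ℝ × ℝ} (hp : p = S.src i ∨ p = S.tgt i) :
    ∃ j ≠ i, S.seg j ⊆ closure F ∩ closure O ∧ (p = S.src j ∨ p = S.tgt j) := by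
  by_contra! hno
  obtain ⟨p', hpp', hsegi⟩ : ∃ p', p ≠ p' ∧ S.seg i = segment ℝ p p' ∧
      (p' = S.src i ∨ p' = S.tgt i) := by
    rcases hp with rfl | rfl
    · exact ⟨_, S.ne i, rfl, Or.inr rfl⟩
    · exact ⟨_, (S.ne i).symm, segment_symm _ _ _, Or.inl rfl⟩
  have hpi : p ∈ S.seg i := hsegi.1 ▸ left_mem_segment ℝ p p'
  let P : Set (ℝ × ℝ) := (range S.src ∪ range S.tgt) \ {p}
  have hcl : IsClosed ((⋃ j : {j // p ∉ S.seg j}, S.seg j) ∪ P) :=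
    (isClosed_iUnion_of_finite fun j : {j // p ∉ S.seg j} => S.isClosed_seg j).union
      (((finite_range S.src).union (finite_range S.tgt)).sdiff (t := {p})).isClosed
  have hpn : p ∉ (⋃ j : {j // p ∉ S.seg j}, S.seg j) ∪ P := by
    rintro (h | h)
    · obtain ⟨⟨j, hj⟩, h⟩ := mem_iUnion.1 h
      exact hj h
    · exact h.2 rfl
  obtain ⟨r, hr, hball⟩ := Metric.isOpen_iff.1 hcl.isOpen_compl p hpn
  have hp' : p' ∉ Metric.ball p r := fun h => hball h <| Or.inr
    ⟨hsegi.2.imp (fun h => ⟨i, h.symm⟩) (fun h => ⟨i, h.symm⟩), hpp'.symm⟩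
  -- The ball contains no segment end but `p`. Any other segment contributing a separating point
  -- here would separate throughout and end at `p`, which is excluded.
  have hJ : Metric.ball p r ∩ (closure F ∩ closure O) ⊆ S.seg i := by
    rintro q ⟨hq, hqJ⟩
    by_cases hqp : q = p
    · exact hqp ▸ hpi
    obtain ⟨j, hj⟩ := mem_iUnion.1 (S.closure_inter_closure_subset_support hF hO hd hu hqJ)
    by_cases hji : j = i
    · exact hji ▸ hj
    have hpj : p ∈ S.seg j := by
      by_contra hpj
      exact hball hq (Or.inl (mem_iUnion.2 ⟨⟨j, hpj⟩, hj⟩))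
    have hqo : q ∈ S.openSeg j := by
      have hj' := hj
      rw [seg, ← insert_endpoints_openSegment] at hj'
      rcases hj' with h | h | h
      · exact absurd (Or.inr ⟨Or.inl ⟨j, h.symm⟩, hqp⟩) (hball hq)
      · exact absurd (Or.inr ⟨Or.inr ⟨j, h.symm⟩, hqp⟩) (hball hq)
      · exact h
    have hpo : p ∉ S.openSeg j := fun h => disjoint_left.1 (S.disj j i hji) h hpi
    have hJj := S.seg_subset_closure_inter_closure hF hO hd hu ⟨q, hqo, hqJ⟩
    rw [seg, ← insert_endpoints_openSegment] at hpj
    rcases hpj with h | h | h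
    · exact absurd h (hno j hji hJj).1
    · exact absurd h (hno j hji hJj).2
    · exact absurd h hpo
  -- The slit ball is connected and misses `closure F ∩ closure O`, so it misses one of the two
  -- closures. But `F` and `O` both have points in it.
  have hW := isPreconnected_ball_diff_segment hr hp'
  rw [← hsegi.1] at hW
  have hcover := S.closure_union_closure_eq_univ hu
  have hoff : ∀ A : Set (ℝ × ℝ), A ⊆ S.supportᶜ → p ∈ closure A →
      ¬ Metric.ball p r \ S.seg i ⊆ (closure A)ᶜ := by
    intro A hA hpA hsub
    obtain ⟨q, hq, hqA⟩ := mem_closure_iff.1 hpA _ Metric.isOpen_ball (Metric.mem_ball_self hr)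
    exact hsub ⟨hq, fun h => hA hqA (S.seg_subset_support i h)⟩ (subset_closure hqA)
  rcases hW.subset_or_subset (isClosed_closure (s := F)).isOpen_compl
    (isClosed_closure (s := O)).isOpen_compl
    (disjoint_compl_left_iff_subset.2 (compl_subset_iff_union.2 (by rwa [union_comm]))) (by
      rw [← compl_inter]
      exact fun q hq hqJ => hq.2 (hJ ⟨hq.1, hqJ⟩)) with h | h
  · exact hoff F (subset_union_left.trans hu.le) (hi hpi).1 h
  · exact hoff O (subset_union_right.trans hu.le) (hi hpi).2 h

/-- Two complementary nonempty open parts of the complement are separated by some segment. -/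
lemma exists_seg_subset [Finite ι] {F O : Set (ℝ × ℝ)} (hF : IsOpen F) (hO : IsOpen O)
    (hd : Disjoint F O) (hu : F ∪ O = S.supportᶜ) (hFne : F.Nonempty) (hOne : O.Nonempty) :
    ∃ i, S.seg i ⊆ closure F ∩ closure O := by
  by_contra! hno
  have hJ : closure F ∩ closure O ⊆ range S.src ∪ range S.tgt := by
    intro q hq
    obtain ⟨i, hi⟩ := mem_iUnion.1 (S.closure_inter_closure_subset_support hF hO hd hu hq)
    rw [seg, ← insert_endpoints_openSegment] at hi
    rcases hi with h | h | h
    · exact Or.inl ⟨i, h.symm⟩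
    · exact Or.inr ⟨i, h.symm⟩
    · exact absurd (S.seg_subset_closure_inter_closure hF hO hd hu ⟨q, h, hq⟩) (hno i)
  -- Removing finitely many points does not disconnect the plane, yet the complements of the two
  -- closures would split what remains.
  have hcount : (closure F ∩ closure O).Countable :=
    (((finite_range S.src).union (finite_range S.tgt)).subset hJ).countable
  have hconn := (hcount.isConnected_compl_of_one_lt_rank
    (by rw [← Module.finrank_eq_rank]; simp)).isPreconnected
  have hcover := S.closure_union_closure_eq_univ hu
  obtain ⟨x, hx⟩ := hFne
  obtain ⟨y, hy⟩ := hOne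
  have hxO : x ∉ closure O := disjoint_left.1 (hd.closure_right hF) hx
  have hyF : y ∉ closure F := fun h => disjoint_left.1 (hd.closure_left hO) h hy
  rcases hconn.subset_or_subset (isClosed_closure (s := F)).isOpen_compl
    (isClosed_closure (s := O)).isOpen_compl
    (disjoint_compl_left_iff_subset.2 (compl_subset_iff_union.2 (by rwa [union_comm])))
    (compl_inter _ _).le with h | h
  · exact h (fun h' => hxO h'.2) (subset_closure hx)
  · exact h (fun h' => hyF h'.1) (subset_closure hy)

end SegmentDrawing

/-! ### Winding functions of weighted segments -/

namespace SegmentDrawing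

open Filter Topology Complex

variable {ι : Type*} (S : SegmentDrawing ι)

/-- The quotient of the vectors from `q` to the two ends of the segment `i`, as complex numbers. -/
noncomputable def ratio (i : ι) (q : ℝ × ℝ) : ℂ :=
  (equivRealProdCLM.symm (S.tgt i) - equivRealProdCLM.symm q) /
    (equivRealProdCLM.symm (S.src i) - equivRealProdCLM.symm q)

lemma src_sub_ne_zero {i : ι} {q : ℝ × ℝ} (hq : q ∉ S.seg i) :
    equivRealProdCLM.symm (S.src i) - equivRealProdCLM.symm q ≠ 0 := by
  rw [sub_ne_zero, equivRealProdCLM.symm.injective.ne_iff]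
  rintro rfl
  exact hq (left_mem_segment ℝ _ _)

lemma tgt_sub_ne_zero {i : ι} {q : ℝ × ℝ} (hq : q ∉ S.seg i) :
    equivRealProdCLM.symm (S.tgt i) - equivRealProdCLM.symm q ≠ 0 := by
  rw [sub_ne_zero, equivRealProdCLM.symm.injective.ne_iff]
  rintro rfl
  exact hq (right_mem_segment ℝ _ _)

/-- A real quotient `t ≤ 0` means that the two ends are seen from `q` in opposite directions, which
puts `q` on the segment at parameter `1 / (1 - t)`. Hence the principal logarithm is smooth off the
segment. -/
lemma ratio_mem_slitPlane {i : ι} {q : ℝ × ℝ} (hq : q ∉ S.seg i) :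
    S.ratio i q ∈ slitPlane := by
  have ha := S.src_sub_ne_zero hq
  by_contra h
  rw [mem_slitPlane_iff_not_le_zero, not_not] at h
  obtain ⟨t, ht, hr⟩ : ∃ t : ℝ, t ≤ 0 ∧ S.ratio i q = t :=
    ⟨(S.ratio i q).re, (Complex.le_def.1 h).1, by
      apply Complex.ext <;> simp [(Complex.le_def.1 h).2]⟩
  rw [ratio, div_eq_iff ha] at hr
  apply hq
  have h1 : (0 : ℝ) < 1 - t := by linarith
  have hc : (1 - t : ℂ) ≠ 0 := by exact_mod_cast h1.ne'
  have hv : S.tgt i - q = t • (S.src i - q) := by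
    apply equivRealProdCLM.symm.injective
    simpa [map_sub, map_smul] using hr
  rw [seg, segment_eq_image]
  refine ⟨1 / (1 - t), ⟨by positivity, by rw [div_le_one h1]; linarith⟩, ?_⟩
  have h2 : S.tgt i = q + t • (S.src i - q) := by rw [← hv]; abel
  simp only [h2]
  ext <;> simp <;> field_simp <;> ring

/-- The logarithmic winding function of the weighted family `z` of segments. -/
noncomputable def winding [Fintype ι] (z : ι → ℂ) (q : ℝ × ℝ) : ℂ :=
  ∑ i, z i * log (S.ratio i q)

lemma hasFDerivAt_log_ratio {i : ι} {q : ℝ × ℝ} (hq : q ∉ S.seg i) :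
    HasFDerivAt (fun q => log (S.ratio i q))
      ((1 / (equivRealProdCLM.symm (S.src i) - equivRealProdCLM.symm q) -
        1 / (equivRealProdCLM.symm (S.tgt i) - equivRealProdCLM.symm q)) •
          (equivRealProdCLM.symm : ℝ × ℝ →L[ℝ] ℂ)) q := by
  have ha := S.src_sub_ne_zero hq
  have hb := S.tgt_sub_ne_zero hq
  have hm : (equivRealProdCLM.symm (S.tgt i) - equivRealProdCLM.symm q) /
    (equivRealProdCLM.symm (S.src i) - equivRealProdCLM.symm q) ∈ slitPlane :=
      S.ratio_mem_slitPlane hq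
  have hd : HasDerivAt (fun w : ℂ => log ((equivRealProdCLM.symm (S.tgt i) - w) /
      (equivRealProdCLM.symm (S.src i) - w)))
      (1 / (equivRealProdCLM.symm (S.src i) - equivRealProdCLM.symm q) -
        1 / (equivRealProdCLM.symm (S.tgt i) - equivRealProdCLM.symm q))
      (equivRealProdCLM.symm q) := by
    have h := ((((hasDerivAt_id (equivRealProdCLM.symm q)).const_sub
      (equivRealProdCLM.symm (S.tgt i))).div ((hasDerivAt_id (equivRealProdCLM.symm q)).const_sub
      (equivRealProdCLM.symm (S.src i))) ha).clog hm)
    refine h.congr_deriv ?_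
    simp only [Pi.div_apply, id]
    field_simp
    ring
  have := (hd.hasFDerivAt.restrictScalars ℝ).comp q
    (equivRealProdCLM.symm : ℝ × ℝ →L[ℝ] ℂ).hasFDerivAt
  refine this.congr_fderiv ?_
  ext <;> simp [mul_comm]

/-- A weighted family of segments is circular if it is a cycle of one-dimensional chains. -/
def IsCircular [Fintype ι] (z : ι → ℂ) : Prop :=
  ∀ h : ℝ × ℝ → ℂ, ∑ i, z i * (h (S.tgt i) - h (S.src i)) = 0

variable {S}

lemma IsCircular.hasFDerivAt_winding [Fintype ι] {z : ι → ℂ} (hz : S.IsCircular z)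
    {q : ℝ × ℝ} (hq : q ∉ S.support) :
    HasFDerivAt (S.winding z) (0 : ℝ × ℝ →L[ℝ] ℂ) q := by
  have hqi : ∀ i, q ∉ S.seg i := fun i h => hq (S.seg_subset_support i h)
  have h := HasFDerivAt.fun_sum (u := Finset.univ)
    (fun i _ => (S.hasFDerivAt_log_ratio (hqi i)).const_mul (z i))
  refine h.congr_fderiv ?_
  simp_rw [smul_smul, ← Finset.sum_smul]
  -- The derivative of each logarithm is the increment of this function along the segment.
  have := hz (fun p => -1 / (equivRealProdCLM.symm p - equivRealProdCLM.symm q))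
  rw [show (∑ i, z i * (1 / (equivRealProdCLM.symm (S.src i) - equivRealProdCLM.symm q) -
    1 / (equivRealProdCLM.symm (S.tgt i) - equivRealProdCLM.symm q))) = 0 from ?_, zero_smul]
  rw [← this]
  refine Finset.sum_congr rfl fun i _ => ?_
  ring

/-- The winding function of a circular family is constant on the faces. -/
lemma IsCircular.winding_eq [Fintype ι] {z : ι → ℂ} (hz : S.IsCircular z) {X : Set (ℝ × ℝ)}
    (hX : IsOpen X) (hX' : IsPreconnected X) (hXS : X ⊆ S.supportᶜ) {x y : ℝ × ℝ} (hx : x ∈ X)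
    (hy : y ∈ X) : S.winding z x = S.winding z y :=
  hX.is_const_of_fderiv_eq_zero hX'
    (fun _ hq => (hz.hasFDerivAt_winding (hXS hq)).differentiableAt.differentiableWithinAt)
    (fun _ hq => (hz.hasFDerivAt_winding (hXS hq)).fderiv) hx hy

variable (S)

/-- The midpoint of a segment, moved off the segment by a multiple of the normal vector. -/
noncomputable def offMidpoint (i : ι) (t : ℝ) : ℝ × ℝ :=
  midpoint ℝ (S.src i) (S.tgt i) + t • S.normal i

lemma midpoint_mem_openSeg (i : ι) : midpoint ℝ (S.src i) (S.tgt i) ∈ S.openSeg i := by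
  rw [openSeg, openSegment_eq_image_lineMap]
  exact ⟨1 / 2, by norm_num, by simp [midpoint]⟩

/-- The normal is `I` times the direction of the segment, so the direction cancels from the
quotient. -/
lemma ratio_offMidpoint (i : ι) (t : ℝ) :
    S.ratio i (S.offMidpoint i t) = (1 - 2 * t * I) / (-1 - 2 * t * I) := by
  have hab := S.ne i
  set d : ℂ := equivRealProdCLM.symm (S.tgt i) - equivRealProdCLM.symm (S.src i) with hd
  have hd0 : d ≠ 0 := by
    rw [hd, sub_ne_zero, equivRealProdCLM.symm.injective.ne_iff]
    exact hab.symm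
  have h1 : equivRealProdCLM.symm (S.tgt i) - equivRealProdCLM.symm (S.offMidpoint i t) =
      d / 2 * (1 - 2 * t * I) := by
    apply Complex.ext <;> simp [hd, offMidpoint, normal, midpoint_eq_smul_add] <;> ring
  have h2 : equivRealProdCLM.symm (S.src i) - equivRealProdCLM.symm (S.offMidpoint i t) =
      d / 2 * (-1 - 2 * t * I) := by
    apply Complex.ext <;> simp [hd, offMidpoint, normal, midpoint_eq_smul_add] <;> ring
  rw [ratio, h1, h2, mul_div_mul_left _ _ (by simpa using hd0)]

/-- The sign of `t` decides on which side of the branch cut the quotient approaches -1. -/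
lemma im_ratio_offMidpoint (i : ι) (t : ℝ) :
    (S.ratio i (S.offMidpoint i t)).im = t * (4 / (1 + 4 * t ^ 2)) := by
  have : (-1 - 2 * t * I : ℂ) ≠ 0 := fun h => by simpa using congrArg re h
  have hp : (0 : ℝ) < 1 + 4 * t ^ 2 := by positivity
  rw [ratio_offMidpoint, div_im]
  simp [normSq_apply]
  field_simp
  ring

lemma continuous_ratio_offMidpoint (i : ι) :
    Continuous fun t => S.ratio i (S.offMidpoint i t) := by
  simp_rw [ratio_offMidpoint]
  refine Continuous.div (by fun_prop) (by fun_prop) fun t h => by simpa using congrArg re h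

lemma tendsto_offMidpoint (i : ι) {f : Filter ℝ} (hf : f ≤ 𝓝 0) :
    Tendsto (S.offMidpoint i) f (𝓝 (midpoint ℝ (S.src i) (S.tgt i))) :=
  S.tendsto_add_normal i _ hf

lemma eventually_offMidpoint_notMem [Finite ι] (i : ι) {f : Filter ℝ} (hf : f ≤ 𝓝 0)
    (hf' : ∀ᶠ t in f, t ≠ 0) : ∀ᶠ t in f, S.offMidpoint i t ∉ S.support := by
  obtain ⟨r, hr, h⟩ := S.exists_ball_inter_support (S.midpoint_mem_openSeg i)
  filter_upwards [(S.tendsto_offMidpoint i hf).eventually (Metric.ball_mem_nhds _ hr), hf']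
    with t ht ht' hs
  have h0 := (h _ ht).1.1 hs
  have hm := ((h _ (Metric.mem_ball_self hr)).1.1
    (S.seg_subset_support i (S.openSeg_subset_seg i (S.midpoint_mem_openSeg i))))
  rw [offMidpoint, side_add_normal, hm, zero_add] at h0
  exact (mul_ne_zero ht' (S.normSq_pos i).ne') h0

/-- A circular family is determined by its winding function up to a constant: the winding function
jumps by `2πi` times the weight of a segment across that segment. -/
lemma eq_zero_of_winding_eq_const [Fintype ι] {z : ι → ℂ} {c : ℂ}
    (hc : ∀ q ∉ S.support, S.winding z q = c) : z = 0 := by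
  classical
  funext i
  set m := midpoint ℝ (S.src i) (S.tgt i)
  have hm := S.midpoint_mem_openSeg i
  -- The other segments contribute continuously at the midpoint, so only segment `i` can produce a
  -- jump there.
  let g : ℝ × ℝ → ℂ := fun q => ∑ j ∈ Finset.univ.erase i, z j * log (S.ratio j q)
  have hg : ContinuousAt g m := by
    refine tendsto_finsetSum _ fun j hj => ?_
    have hmj : m ∉ S.seg j := disjoint_left.1 (S.disj i j (Finset.ne_of_mem_erase hj).symm) hm
    exact (((S.hasFDerivAt_log_ratio hmj).const_mul (z j)).continuousAt)
  have hw : ∀ q, S.winding z q = z i * log (S.ratio i q) + g q := fun q =>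
    (Finset.add_sum_erase _ _ (Finset.mem_univ i)).symm
  have h0 : S.ratio i (S.offMidpoint i 0) = -1 := by rw [ratio_offMidpoint]; norm_num
  have hr : Tendsto (fun t => S.ratio i (S.offMidpoint i t)) (𝓝 0) (𝓝 (-1)) := by
    have := (S.continuous_ratio_offMidpoint i).tendsto 0
    rwa [h0] at this
  have hpos : Tendsto (fun t => log (S.ratio i (S.offMidpoint i t))) (𝓝[>] 0)
      (𝓝 (Real.log ‖(-1 : ℂ)‖ + Real.pi * I)) := by
    refine (tendsto_log_nhdsWithin_im_nonneg_of_re_neg_of_im_zero (by simp) (by simp)).comp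
      (tendsto_nhdsWithin_iff.2 ⟨hr.mono_left inf_le_left, ?_⟩)
    filter_upwards [self_mem_nhdsWithin] with t ht
    have ht' : 0 < t := ht
    change 0 ≤ _
    rw [im_ratio_offMidpoint]
    positivity
  have hneg : Tendsto (fun t => log (S.ratio i (S.offMidpoint i t))) (𝓝[<] 0)
      (𝓝 (Real.log ‖(-1 : ℂ)‖ - Real.pi * I)) := by
    refine (tendsto_log_nhdsWithin_im_neg_of_re_neg_of_im_zero (by simp) (by simp)).comp
      (tendsto_nhdsWithin_iff.2 ⟨hr.mono_left inf_le_left, ?_⟩)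
    filter_upwards [self_mem_nhdsWithin] with t ht
    have ht' : t < 0 := ht
    change _ < 0
    rw [im_ratio_offMidpoint]
    exact mul_neg_of_neg_of_pos ht' (by positivity)
  have lim : ∀ {f : Filter ℝ} {l : ℂ}, f.NeBot → f ≤ 𝓝 0 → (∀ᶠ t in f, t ≠ 0) →
      Tendsto (fun t => log (S.ratio i (S.offMidpoint i t))) f (𝓝 l) → z i * l + g m = c := by
    intro f l _ hf hf' hl
    refine tendsto_nhds_unique ((hl.const_mul (z i)).add
      (hg.tendsto.comp (S.tendsto_offMidpoint i hf))) (tendsto_const_nhds.congr' ?_)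
    filter_upwards [S.eventually_offMidpoint_notMem i hf hf'] with t ht
    rw [← hc _ ht, hw]; rfl
  have e1 := lim (f := 𝓝[>] 0) inferInstance inf_le_left
    (by filter_upwards [self_mem_nhdsWithin] with t ht using ne_of_gt ht) hpos
  have e2 := lim (f := 𝓝[<] 0) inferInstance inf_le_left
    (by filter_upwards [self_mem_nhdsWithin] with t ht using ne_of_lt ht) hneg
  have e3 : z i * (2 * Real.pi * I) = 0 := by linear_combination e1 - e2
  simpa [Real.pi_ne_zero] using e3

/-! ### Faces and the dimension bound -/

/-- The faces: the connected components of the complement of the drawing. -/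
def faces : Set (Set (ℝ × ℝ)) :=
  {F | ∃ z ∈ S.supportᶜ, F = connectedComponentIn S.supportᶜ z}

/-- The space of circular weights on the segments embeds, together with the constants, into the
functions on the faces. -/
lemma finrank_add_one_le_card_faces [Fintype ι] {M : Type*} [AddCommGroup M] [Module ℂ M]
    [FiniteDimensional ℂ M]
    (Z : M →ₗ[ℂ] (ι → ℂ)) (hinj : Function.Injective Z) (hcirc : ∀ x, S.IsCircular (Z x))
    (hfin : S.faces.Finite) : Module.finrank ℂ M + 1 ≤ S.faces.ncard := by
  have := hfin.fintype
  choose rep hrep hF using fun F : S.faces => F.2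
  let Φ : (M × ℂ) →ₗ[ℂ] (S.faces → ℂ) :=
    { toFun := fun x F => S.winding (Z x.1) (rep F) + x.2
      map_add' := fun x y => by
        funext F
        simp [winding, add_mul, Finset.sum_add_distrib]; ring
      map_smul' := fun c x => by
        funext F
        simp [winding, mul_add, Finset.mul_sum, mul_assoc] }
  have hΦ : Function.Injective Φ := by
    rw [injective_iff_map_eq_zero]
    rintro ⟨x, c⟩ h
    -- Vanishing at one representative per face forces the winding function to be constant off the
    -- drawing, so all weights vanish, and then `c` does.
    have hconst : ∀ q ∉ S.support, S.winding (Z x) q = -c := by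
      intro q hq
      let F : S.faces := ⟨_, q, hq, rfl⟩
      have h1 : S.winding (Z x) (rep F) + c = 0 := congrFun h F
      have hqF : q ∈ connectedComponentIn S.supportᶜ (rep F) :=
        (hF F) ▸ mem_connectedComponentIn hq
      rw [(hcirc x).winding_eq S.isClosed_support.isOpen_compl.connectedComponentIn
        isPreconnected_connectedComponentIn (connectedComponentIn_subset _ _) hqF
        (mem_connectedComponentIn (hrep F))]
      linear_combination h1
    have hx : x = 0 := hinj (by rw [S.eq_zero_of_winding_eq_const hconst, map_zero])
    subst hx
    obtain ⟨q, hq⟩ := S.dense_compl_support.nonempty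
    have := hconst q hq
    simp [winding] at this
    simpa using this
  have := LinearMap.finrank_le_finrank_of_injective hΦ
  rwa [Module.finrank_prod, Module.finrank_self, Module.finrank_fintype_fun_eq_card,
    ← Nat.card_eq_fintype_card] at this

lemma isOpen_of_mem_faces [Finite ι] {F : Set (ℝ × ℝ)} (hF : F ∈ S.faces) : IsOpen F := by
  obtain ⟨z, -, rfl⟩ := hF
  exact S.isClosed_support.isOpen_compl.connectedComponentIn

lemma eq_connectedComponentIn_of_mem_faces {F : Set (ℝ × ℝ)} (hF : F ∈ S.faces) {q : ℝ × ℝ}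
    (hq : q ∈ F) : F = connectedComponentIn S.supportᶜ q := by
  obtain ⟨z, -, rfl⟩ := hF
  exact connectedComponentIn_eq hq

lemma subset_compl_support_of_mem_faces {F : Set (ℝ × ℝ)} (hF : F ∈ S.faces) :
    F ⊆ S.supportᶜ := by
  obtain ⟨z, -, rfl⟩ := hF
  exact connectedComponentIn_subset _ _

/-- This set is the union of the other faces; it plays the role of `O` in the separation lemmas. -/
lemma isOpen_compl_support_diff_face [Finite ι] {F : Set (ℝ × ℝ)} (hF : F ∈ S.faces) :
    IsOpen (S.supportᶜ \ F) := by
  have : S.supportᶜ \ F = ⋃₀ (S.faces \ {F}) := by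
    ext q
    constructor
    · rintro ⟨hq, hqF⟩
      exact ⟨_, ⟨⟨q, hq, rfl⟩, fun h => hqF (h ▸ mem_connectedComponentIn hq)⟩,
        mem_connectedComponentIn hq⟩
    · rintro ⟨F', ⟨hF', hne⟩, hq⟩
      refine ⟨S.subset_compl_support_of_mem_faces hF' hq, fun hqF => hne ?_⟩
      exact (S.eq_connectedComponentIn_of_mem_faces hF' hq).trans
        (S.eq_connectedComponentIn_of_mem_faces hF hqF).symm
  rw [this]
  exact isOpen_sUnion fun F' hF' => S.isOpen_of_mem_faces hF'.1

/-- At most two faces are adjacent to an interior point of a segment. -/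
lemma exists_faces_of_mem_openSeg [Finite ι] {i : ι} {p : ℝ × ℝ} (hp : p ∈ S.openSeg i) :
    ∃ F₁ F₂, ∀ F ∈ S.faces, p ∈ closure F → F = F₁ ∨ F = F₂ := by
  obtain ⟨U, H₁, H₂, hU, hpU, h₁, h₂, hs₁, hs₂, hcov, hcl, -⟩ := S.exists_two_sides hp
  obtain ⟨hp₁, hp₂⟩ := hcl ⟨hpU, S.seg_subset_support i (S.openSeg_subset_seg i hp)⟩
  obtain ⟨x₁, hx₁⟩ := closure_nonempty_iff.1 ⟨p, hp₁⟩
  obtain ⟨x₂, hx₂⟩ := closure_nonempty_iff.1 ⟨p, hp₂⟩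
  refine ⟨connectedComponentIn S.supportᶜ x₁, connectedComponentIn S.supportᶜ x₂,
    fun F hF hpF => ?_⟩
  obtain ⟨q, hqU, hqF⟩ := mem_closure_iff.1 hpF U hU hpU
  rw [S.eq_connectedComponentIn_of_mem_faces hF hqF]
  refine (hcov ⟨hqU, S.subset_compl_support_of_mem_faces hF hqF⟩).imp (fun hq => ?_) fun hq => ?_
  · exact (connectedComponentIn_eq (h₁.subset_connectedComponentIn hx₁ hs₁ hq)).symm
  · exact (connectedComponentIn_eq (h₂.subset_connectedComponentIn hx₂ hs₂ hq)).symm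

end SegmentDrawing

/-! ### Cycles and degree counting in multigraphs -/

namespace Graph

variable {α β : Type*}

/-- A nonempty set of edges in which every edge can be continued, at each of its ends, by another
edge or by itself if it is a loop, contains a cycle. -/
lemma exists_isCycle_of_forall_continued {G : Graph α β} (hfin : V(G).Finite) {K : Set β}
    {e₀ : β} {x₀ y₀ : α} (he₀ : e₀ ∈ K) (hl₀ : G.IsLink e₀ x₀ y₀)
    (hstep : ∀ e ∈ K, ∀ x y, G.IsLink e x y →
      ∃ f ∈ K, ∃ z, G.IsLink f y z ∧ (f ≠ e ∨ x = y)) :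
    ∃ (n : ℕ) (v : Fin n → α) (e : Fin n → β), G.IsCycle n v e ∧ ∀ i, e i ∈ K := by
  classical
  -- Directed edges of `K`. Iterating `next` gives an infinite walk that repeats an edge at once
  -- only when it is a loop.
  let T := {t : α × β × α // t.2.1 ∈ K ∧ G.IsLink t.2.1 t.1 t.2.2}
  have hnext : ∀ t : T, ∃ t' : T, t'.1.1 = t.1.2.2 ∧
      (t'.1.2.1 ≠ t.1.2.1 ∨ t.1.1 = t.1.2.2) := by
    rintro ⟨⟨x, e, y⟩, he, hl⟩
    obtain ⟨f, hf, z, hz, h⟩ := hstep e he x y hl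
    exact ⟨⟨⟨y, f, z⟩, hf, hz⟩, rfl, h⟩
  choose next hnext₁ hnext₂ using hnext
  let seq : ℕ → T := fun k => next^[k] ⟨⟨x₀, e₀, y₀⟩, he₀, hl₀⟩
  have hseq : ∀ k, seq (k + 1) = next (seq k) := fun k => Function.iterate_succ_apply' _ _ _
  let w : ℕ → α := fun k => (seq k).1.1
  let d : ℕ → β := fun k => (seq k).1.2.1
  have hw : ∀ k, w (k + 1) = (seq k).1.2.2 := fun k => by simp only [w, hseq, hnext₁]
  have hlink : ∀ k, G.IsLink (d k) (w k) (w (k + 1)) := fun k => by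
    rw [hw]; exact (seq k).2.2
  have hd : ∀ k, d (k + 1) ≠ d k ∨ w k = w (k + 1) := fun k => by
    rw [hw]; simp only [d, hseq]; exact hnext₂ _
  have hrep : ∃ m, 0 < m ∧ ∃ i, w i = w (i + m) := by
    obtain ⟨a, -, b, -, hab, h⟩ := Set.infinite_univ.exists_ne_map_eq_of_mapsTo (f := w)
      (fun k _ => (hlink k).left_mem) hfin
    rcases lt_or_gt_of_ne hab with hlt | hlt
    · exact ⟨b - a, by omega, a, by rw [h]; congr 1; omega⟩
    · exact ⟨a - b, by omega, b, by rw [← h]; congr 1; omega⟩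
  -- A shortest return, over all starting times, has no repeated vertex within it.
  obtain ⟨hm, i, hi⟩ := Nat.find_spec hrep
  have hmin : ∀ a b, a < b → b < Nat.find hrep → w (i + a) ≠ w (i + b) := by
    intro a b hab hb h
    exact Nat.find_min hrep (m := b - a) (by omega)
      ⟨by omega, i + a, by rw [h]; congr 1; omega⟩
  generalize Nat.find hrep = m at hm hi hmin
  obtain ⟨m, rfl⟩ : ∃ k, m = k + 1 := ⟨m - 1, by omega⟩
  have hdmin : ∀ a b, a < b → b < m + 1 → d (i + a) ≠ d (i + b) := by
    intro a b hab hb h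
    rcases (hlink (i + a)).eq_and_eq_or_eq_and_eq (h ▸ hlink (i + b)) with ⟨h1, -⟩ | ⟨-, h2⟩
    · exact hmin a b hab hb h1
    -- An edge traversed backwards must be reversed immediately, since otherwise its far end repeats
    -- too early.
    · have hb' : b = a + 1 := by
        by_contra hne
        exact hmin (a + 1) b (by omega) hb h2
      subst hb'
      rcases hd (i + a) with h3 | h3
      · exact h3 h.symm
      · exact hmin a (a + 1) hab hb h3
  refine ⟨m + 1, fun k => w (i + k), fun k => d (i + k), ⟨hm, ?_, ?_, ?_⟩,
    fun k => (seq (i + k)).2.1⟩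
  · intro a b h
    rcases lt_trichotomy a b with hlt | rfl | hlt
    · exact absurd h (hmin a b hlt b.2)
    · rfl
    · exact absurd h.symm (hmin b a hlt a.2)
  · intro a b h
    rcases lt_trichotomy a b with hlt | rfl | hlt
    · exact absurd h (hdmin a b hlt b.2)
    · rfl
    · exact absurd h.symm (hdmin b a hlt a.2)
  · intro k
    have := hlink (i + k)
    rw [finRotate_apply]
    rcases eq_or_ne k (Fin.last m) with rfl | hk
    · simpa [hi, add_assoc] using this
    · rwa [Fin.val_add_one_of_lt (Fin.lt_last_iff_ne_last.2 hk)]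

lemma IsCubic.finite_edgeSet {G : Graph α β} (hG : G.IsCubic) (hfin : V(G).Finite) :
    E(G).Finite := by
  refine (hfin.biUnion (t := fun x => G.incidenceSet x) fun x hx => ?_).subset fun e he => ?_
  · refine Set.finite_of_encard_le_coe (k := 3) ?_
    rw [Nat.cast_ofNat, ← hG x hx]
    exact le_self_add
  · obtain ⟨x, y, h⟩ := exists_isLink_of_mem_edgeSet he
    exact mem_biUnion h.left_mem h.inc_left

/-- The handshaking lemma for cubic graphs. -/
lemma IsCubic.three_mul_ncard_le {G : Graph α β} (hG : G.IsCubic) (hfin : V(G).Finite) :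
    3 * V(G).ncard ≤ 2 * E(G).ncard := by
  classical
  have hE := hG.finite_edgeSet hfin
  have hdeg : ∀ x ∈ hfin.toFinset, 3 = ∑ e ∈ hE.toFinset,
      ((if G.Inc e x then 1 else 0) + (if G.IsLoopAt e x then 1 else 0)) := by
    intro x hx
    have h := hG x (hfin.mem_toFinset.1 hx)
    have h1 : G.incidenceSet x = ↑(hE.toFinset.filter (G.Inc · x)) := by
      ext e
      simp only [mem_incidenceSet, Finset.coe_filter, Finite.mem_toFinset, mem_ofPred_eq]
      exact ⟨fun h => ⟨h.edge_mem, h⟩, fun h => h.2⟩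
    have h2 : G.loopSet x = ↑(hE.toFinset.filter (G.IsLoopAt · x)) := by
      ext e
      simp only [mem_loopSet, Finset.coe_filter, Finite.mem_toFinset, mem_ofPred_eq]
      exact ⟨fun h => ⟨h.edge_mem, h⟩, fun h => h.2⟩
    rw [h1, h2, Set.encard_coe_eq_coe_finsetCard, Set.encard_coe_eq_coe_finsetCard] at h
    rw [Finset.sum_add_distrib, ← Finset.card_filter, ← Finset.card_filter]
    exact_mod_cast h.symm
  have hends : ∀ e ∈ hE.toFinset, ∑ x ∈ hfin.toFinset,
      ((if G.Inc e x then 1 else 0) + (if G.IsLoopAt e x then 1 else 0)) ≤ 2 := by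
    intro e he
    obtain ⟨u, v, huv⟩ := exists_isLink_of_mem_edgeSet (hE.mem_toFinset.1 he)
    rw [Finset.sum_add_distrib, ← Finset.card_filter, ← Finset.card_filter]
    by_cases h : u = v
    · subst h
      have h1 : hfin.toFinset.filter (G.Inc e) ⊆ {u} := fun x hx => by
        simpa using (Finset.mem_filter.1 hx).2.eq_or_eq_of_isLink huv
      have h2 : hfin.toFinset.filter (G.IsLoopAt e) ⊆ {u} := fun x hx => by
        simpa using (Finset.mem_filter.1 hx).2.inc.eq_or_eq_of_isLink huv
      exact add_le_add (Finset.card_le_card h1) (Finset.card_le_card h2)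
    · have h1 : hfin.toFinset.filter (G.Inc e) ⊆ {u, v} := fun x hx => by
        simpa using (Finset.mem_filter.1 hx).2.eq_or_eq_of_isLink huv
      have h2 : hfin.toFinset.filter (G.IsLoopAt e) = ∅ := by
        refine Finset.filter_eq_empty_iff.2 fun x _ hx => h ?_
        exact (hx.eq_of_inc huv.inc_left).symm.trans (hx.eq_of_inc huv.inc_right)
      rw [h2]
      simpa using (Finset.card_le_card h1).trans Finset.card_le_two
  calc 3 * V(G).ncard = ∑ x ∈ hfin.toFinset, 3 := by
        rw [Finset.sum_const, smul_eq_mul, mul_comm, Set.ncard_eq_toFinset_card _ hfin]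
    _ = _ := Finset.sum_congr rfl hdeg
    _ = _ := Finset.sum_comm
    _ ≤ ∑ e ∈ hE.toFinset, 2 := Finset.sum_le_sum hends
    _ = 2 * E(G).ncard := by
        rw [Finset.sum_const, smul_eq_mul, mul_comm, Set.ncard_eq_toFinset_card _ hE]

/-! ### From plane drawings to segments -/

lemma polygonalCurve_natCast_add (p : ℕ → ℝ × ℝ) (k : ℕ) {s : ℝ} (hs : s ∈ Icc (0 : ℝ) 1) :
    polygonalCurve p (k + s) = AffineMap.lineMap (p k) (p (k + 1)) s := by
  rcases hs.2.eq_or_lt with rfl | h1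
  · rw [polygonalCurve, ← Nat.cast_add_one, Nat.floor_natCast]
    simp
  · have hf : ⌊(k : ℝ) + s⌋₊ = k := by
      rw [add_comm, Nat.floor_add_natCast hs.1, Nat.floor_eq_zero.2 h1, zero_add]
    have hr : Int.fract ((k : ℝ) + s) = s := by
      rw [Int.fract_natCast_add, Int.fract_eq_self.2 ⟨hs.1, h1⟩]
    rw [polygonalCurve, hf, hr]

lemma polygonalCurve_natCast (p : ℕ → ℝ × ℝ) (k : ℕ) : polygonalCurve p k = p k := by
  simpa using polygonalCurve_natCast_add p k (s := 0) (by simp)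

namespace PlaneDrawing

variable {G : Graph α β} (D : G.PlaneDrawing)

lemma exists_param_of_mem_segment {e : β} {k : ℕ} {q : ℝ × ℝ}
    (hq : q ∈ segment ℝ (D.corner e k) (D.corner e (k + 1))) :
    ∃ t ∈ Icc (k : ℝ) (k + 1), polygonalCurve (D.corner e) t = q := by
  rw [segment_eq_image_lineMap] at hq
  obtain ⟨s, hs, rfl⟩ := hq
  exact ⟨k + s, ⟨by linarith [hs.1], by linarith [hs.2]⟩, polygonalCurve_natCast_add _ _ hs⟩

lemma exists_param_of_mem_openSegment {e : β} {k : ℕ} {q : ℝ × ℝ}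
    (hq : q ∈ openSegment ℝ (D.corner e k) (D.corner e (k + 1))) :
    ∃ t ∈ Ioo (k : ℝ) (k + 1), polygonalCurve (D.corner e) t = q := by
  rw [openSegment_eq_image_lineMap] at hq
  obtain ⟨s, hs, rfl⟩ := hq
  exact ⟨k + s, ⟨by linarith [hs.1], by linarith [hs.2]⟩,
    polygonalCurve_natCast_add _ _ (Ioo_subset_Icc_self hs)⟩

/-- An interior point of an edge lies on that edge only, and at one time only. -/
lemma eq_of_polygonalCurve_eq {e f : β} (he : e ∈ E(G)) (hf : f ∈ E(G)) {s t : ℝ}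
    (hs : s ∈ Ioo 0 (D.segments e : ℝ)) (ht : t ∈ Icc 0 (D.segments f : ℝ))
    (h : polygonalCurve (D.corner f) t = polygonalCurve (D.corner e) s) : f = e ∧ t = s := by
  obtain ⟨x, y, hl, hx, hy⟩ := D.ends f hf
  rcases ht.1.eq_or_lt with rfl | h0
  · refine absurd ⟨s, hs, ?_⟩ (D.vertex_notMem e he x hl.left_mem)
    rw [← h, ← hx]
    exact_mod_cast polygonalCurve_natCast _ 0
  rcases ht.2.eq_or_lt with rfl | h1
  · refine absurd ⟨s, hs, ?_⟩ (D.vertex_notMem e he y hl.right_mem)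
    rw [← h, ← hy, polygonalCurve_natCast]
  by_cases hfe : f = e
  · subst hfe
    exact ⟨rfl, D.curve_injOn f hf ⟨h0, h1⟩ hs h⟩
  · exact absurd ⟨s, hs, rfl⟩
      (disjoint_left.1 (D.edge_disjoint f hf e he hfe) ⟨t, ⟨h0, h1⟩, h⟩)

/-- The segments of all the edges of a plane drawing. -/
def segmentDrawing : SegmentDrawing (Σ e : E(G), Fin (D.segments e)) where
  src i := D.corner i.1 i.2
  tgt i := D.corner i.1 (i.2 + 1)
  ne := by
    rintro ⟨⟨e, he⟩, k⟩ h
    have hk : (k : ℝ) + 1 ≤ D.segments e := by exact_mod_cast k.2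
    have hk0 : (0 : ℝ) ≤ k := by positivity
    -- On a degenerate segment the curve would stand still, against injectivity; the times 1/3 and
    -- 1/2 are arbitrary.
    have hc : ∀ s ∈ Ioo (0 : ℝ) 1, polygonalCurve (D.corner e) (k + s) = D.corner e k := by
      intro s hs
      rw [polygonalCurve_natCast_add _ _ (Ioo_subset_Icc_self hs)]
      simp only at h
      rw [← h, AffineMap.lineMap_same_apply]
    have := D.curve_injOn e he (x₁ := k + 1 / 3) (x₂ := k + 1 / 2)
      ⟨by linarith, by linarith⟩ ⟨by linarith, by linarith⟩
      ((hc _ (by norm_num)).trans (hc _ (by norm_num)).symm)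
    norm_num at this
  disj := by
    rintro ⟨⟨e, he⟩, k⟩ ⟨⟨f, hf⟩, l⟩ hne
    refine disjoint_left.2 fun q hq hq' => hne ?_
    obtain ⟨s, hs, rfl⟩ := D.exists_param_of_mem_openSegment hq
    obtain ⟨t, ht, h⟩ := D.exists_param_of_mem_segment hq'
    have hk : (k : ℝ) + 1 ≤ D.segments e := by exact_mod_cast k.2
    have hl : (l : ℝ) + 1 ≤ D.segments f := by exact_mod_cast l.2
    have hk0 : (0 : ℝ) ≤ k := by positivity
    have hl0 : (0 : ℝ) ≤ l := by positivity
    obtain ⟨rfl, rfl⟩ := D.eq_of_polygonalCurve_eq he hf ⟨by linarith [hs.1], by linarith [hs.2]⟩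
      ⟨by linarith [ht.1], by linarith [ht.2]⟩ h
    have h1 : (k : ℝ) < l + 1 := by linarith [hs.1, ht.2]
    have h2 : (l : ℝ) < k + 1 := by linarith [hs.2, ht.1]
    have h1' : (k : ℕ) < l + 1 := by exact_mod_cast h1
    have h2' : (l : ℕ) < k + 1 := by exact_mod_cast h2
    have : k = l := Fin.ext (by omega)
    rw [this]

lemma arc_eq {e : β} (he : e ∈ E(G)) :
    D.arc e = ⋃ k : Fin (D.segments e), D.segmentDrawing.seg ⟨⟨e, he⟩, k⟩ := by
  have hpos := D.segments_pos e he
  ext q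
  simp only [arc, mem_image, mem_iUnion]
  constructor
  · rintro ⟨t, ht, rfl⟩
    obtain ⟨k, hk, s, hs, rfl⟩ :
        ∃ k < D.segments e, ∃ s ∈ Icc (0 : ℝ) 1, (k : ℝ) + s = t := by
      rcases ht.2.eq_or_lt with rfl | h1
      -- The final time belongs to the last segment with `s = 1`; its floor would be out of range.
      · exact ⟨D.segments e - 1, by omega, 1, by simp, by
          rw [Nat.cast_pred hpos]; ring⟩
      · refine ⟨⌊t⌋₊, (Nat.floor_lt ht.1).2 h1, t - ⌊t⌋₊, ⟨?_, ?_⟩, by ring⟩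
        · linarith [Nat.floor_le ht.1]
        · linarith [Nat.lt_floor_add_one t]
    refine ⟨⟨k, hk⟩, ?_⟩
    rw [polygonalCurve_natCast_add _ _ hs, SegmentDrawing.seg, segment_eq_image_lineMap]
    exact ⟨s, hs, rfl⟩
  · rintro ⟨k, hk⟩
    obtain ⟨t, ht, rfl⟩ := D.exists_param_of_mem_segment hk
    have hk : (k : ℝ) + 1 ≤ D.segments e := by exact_mod_cast k.2
    have hk0 : (0 : ℝ) ≤ k := by positivity
    exact ⟨t, ⟨by linarith [ht.1], by linarith [ht.2]⟩, rfl⟩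

lemma point_mem_arc {e : β} {x : α} (h : G.Inc e x) : D.point x ∈ D.arc e := by
  obtain ⟨u, v, hl, hu, hv⟩ := D.ends e h.edge_mem
  rcases h.eq_or_eq_of_isLink hl with rfl | rfl
  · exact ⟨0, by simp, by rw [← hu]; exact_mod_cast polygonalCurve_natCast _ 0⟩
  · exact ⟨D.segments e, by simp, by rw [← hv, polygonalCurve_natCast]⟩

/-- Isolated vertices are excluded because they would be points on no segment. -/
lemma support_eq (hinc : ∀ x ∈ V(G), ∃ e, G.Inc e x) : D.support = D.segmentDrawing.support := by
  have h : ⋃ e ∈ E(G), D.arc e = D.segmentDrawing.support := by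
    rw [SegmentDrawing.support, iUnion_sigma, biUnion_eq_iUnion]
    exact iUnion_congr fun e => D.arc_eq e.2
  rw [support, h, union_eq_right, ← h]
  rintro _ ⟨x, hx, rfl⟩
  obtain ⟨e, he⟩ := hinc x hx
  exact mem_biUnion he.edge_mem (D.point_mem_arc he)

lemma faces_eq (hinc : ∀ x ∈ V(G), ∃ e, G.Inc e x) : D.faces = D.segmentDrawing.faces := by
  rw [faces, SegmentDrawing.faces, D.support_eq hinc]

end PlaneDrawing

end Graph

/-! ### Euler's inequality and double counting -/

namespace Graph

variable {α β : Type*}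

namespace PlaneDrawing

variable {G : Graph α β} (D : G.PlaneDrawing)

/-- The lower bound in Euler's formula for the number of faces. -/
lemma ncard_edgeSet_lt_ncard_faces_add (hV : V(G).Finite) (hE : E(G).Finite)
    (hfin : D.segmentDrawing.faces.Finite) :
    E(G).ncard < D.segmentDrawing.faces.ncard + V(G).ncard := by
  classical
  have := hV.fintype
  have := hE.fintype
  choose x y hl hx hy using fun e : E(G) => D.ends e e.2
  -- The boundary operator, each edge being oriented as it is drawn; a loop has boundary zero. The
  -- kernel is the cycle space.
  let B : (E(G) → ℂ) →ₗ[ℂ] (V(G) → ℂ) :=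
    { toFun := fun z v => ∑ e, z e *
        ((if y e = v then 1 else 0) - (if x e = v then 1 else 0))
      map_add' := fun z z' => by
        funext v; simp [add_mul, Finset.sum_add_distrib]
      map_smul' := fun c z => by
        funext v; simp [Finset.mul_sum, mul_assoc] }
  let Z : LinearMap.ker B →ₗ[ℂ] ((Σ e : E(G), Fin (D.segments e)) → ℂ) :=
    { toFun := fun z i => z.1 i.1
      map_add' := fun _ _ => rfl
      map_smul' := fun _ _ => rfl }
  have hinj : Function.Injective Z := fun z z' h => Subtype.ext <| funext fun e =>
    congrFun h ⟨e, ⟨0, D.segments_pos e e.2⟩⟩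
  have hcirc : ∀ z, D.segmentDrawing.IsCircular (Z z) := by
    rintro ⟨z, hz⟩ h
    -- All segments of an edge carry the same weight, so the inner corners cancel and only the ends
    -- remain.
    have htel : ∀ e : E(G), ∑ k : Fin (D.segments e),
        (h (D.corner e (k + 1)) - h (D.corner e k)) = h (D.point (y e)) - h (D.point (x e)) := by
      intro e
      rw [Fin.sum_univ_eq_sum_range (fun k => h (D.corner e (k + 1)) - h (D.corner e k)),
        Finset.sum_range_sub (fun k => h (D.corner e k)), hx, hy]
    have hpick : ∀ u ∈ V(G), ∑ v : V(G), (if u = v then 1 else 0) * h (D.point v) =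
        h (D.point u) := by
      intro u hu
      rw [Finset.sum_eq_single ⟨u, hu⟩ (fun v _ hv => by
        rw [if_neg fun h => hv (Subtype.ext h.symm), zero_mul]) (by simp)]
      simp
    rw [Fintype.sum_sigma]
    calc ∑ e : E(G), ∑ k : Fin (D.segments e),
          z e * (h (D.corner e (k + 1)) - h (D.corner e k))
        = ∑ e : E(G), z e * (h (D.point (y e)) - h (D.point (x e))) :=
          Finset.sum_congr rfl fun e _ => by rw [← Finset.mul_sum, htel]
      _ = ∑ e : E(G), ∑ v : V(G), z e *
          ((if y e = v then 1 else 0) - (if x e = v then 1 else 0)) * h (D.point v) := by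
          refine Finset.sum_congr rfl fun e _ => ?_
          simp_rw [mul_assoc, ← Finset.mul_sum, sub_mul, Finset.sum_sub_distrib]
          rw [hpick _ (hl e).left_mem, hpick _ (hl e).right_mem]
      _ = ∑ v : V(G), B z v * h (D.point v) := by
          rw [Finset.sum_comm]
          exact Finset.sum_congr rfl fun v _ => (Finset.sum_mul _ _ _).symm
      _ = 0 := by simp [LinearMap.mem_ker.1 hz]
  have h1 := D.segmentDrawing.finrank_add_one_le_card_faces Z hinj hcirc hfin
  have h2 := B.finrank_range_add_finrank_ker
  have h3 := (LinearMap.range B).finrank_le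
  rw [Module.finrank_fintype_fun_eq_card, ← Nat.card_eq_fintype_card, Nat.card_coe_set_eq] at h2 h3
  omega

/-- An edge lies on the boundary of at most two faces. -/
lemma exists_faces_of_mem_edgeSet [Finite E(G)] {e : β} (he : e ∈ E(G)) :
    ∃ F₁ F₂, ∀ F ∈ D.segmentDrawing.faces, e ∈ D.boundaryEdges F → F = F₁ ∨ F = F₂ := by
  let i : Σ e : E(G), Fin (D.segments e) := ⟨⟨e, he⟩, ⟨0, D.segments_pos e he⟩⟩
  have hm := D.segmentDrawing.midpoint_mem_openSeg i
  obtain ⟨F₁, F₂, h⟩ := D.segmentDrawing.exists_faces_of_mem_openSeg hm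
  refine ⟨F₁, F₂, fun F hF hb => h F hF (frontier_subset_closure (hb.2 ?_))⟩
  rw [D.arc_eq he]
  exact mem_iUnion.2 ⟨_, D.segmentDrawing.openSeg_subset_seg i hm⟩

/-- Double counting of the pairs of a face and an edge on its boundary. -/
lemma six_mul_card_le (hE : E(G).Finite) {T : Finset (Set (ℝ × ℝ))}
    (hT : ∀ F ∈ T, F ∈ D.segmentDrawing.faces)
    (h : ∀ F ∈ T, ¬ (D.boundaryEdges F).encard ≤ 5) : T.card * 6 ≤ E(G).ncard * 2 := by
  classical
  have := hE.to_subtype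
  rw [Set.ncard_eq_toFinset_card _ hE]
  refine Finset.card_mul_le_card_mul (fun F e => e ∈ D.boundaryEdges F) (fun F hF => ?_)
    fun e he => ?_
  · have hb : D.boundaryEdges F =
        ↑(hE.toFinset.bipartiteAbove (fun F e => e ∈ D.boundaryEdges F) F) := by
      ext e
      simp only [Finset.coe_bipartiteAbove, Finite.mem_toFinset, mem_ofPred_eq]
      exact ⟨fun h => ⟨h.1, h⟩, fun h => h.2⟩
    have h5 := h F hF
    rw [hb, Set.encard_coe_eq_coe_finsetCard, not_le] at h5
    exact_mod_cast Order.add_one_le_of_lt h5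
  · obtain ⟨F₁, F₂, h2⟩ := D.exists_faces_of_mem_edgeSet (hE.mem_toFinset.1 he)
    have hsub : T.bipartiteBelow (fun F e => e ∈ D.boundaryEdges F) e ⊆ {F₁, F₂} := by
      intro F hF
      obtain ⟨hFT, hFe⟩ := (Finset.mem_bipartiteBelow _).1 hF
      simpa using h2 F (hT F hFT) hFe
    exact (Finset.card_le_card hsub).trans Finset.card_le_two

/-! ### Edges separating two open parts of the complement -/

section Separation

variable {F O : Set (ℝ × ℝ)}

lemma exists_seg_subset_of_corner [Finite E(G)] (hF : IsOpen F) (hO : IsOpen O)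
    (hd : Disjoint F O) (hu : F ∪ O = D.segmentDrawing.supportᶜ) {e : E(G)}
    {k : Fin (D.segments e)} {c : ℕ} (hck : c = k ∨ c = k + 1)
    (hk : D.segmentDrawing.seg ⟨e, k⟩ ⊆ closure F ∩ closure O) :
    ∃ (f : E(G)) (m : Fin (D.segments f)) (c' : ℕ), (c' = m ∨ c' = m + 1) ∧
      D.corner f c' = D.corner e c ∧ D.segmentDrawing.seg ⟨f, m⟩ ⊆ closure F ∩ closure O ∧
      (f = e → (m : ℕ) ≠ k) := by
  obtain ⟨⟨f, m⟩, hne, hm, hpm⟩ := D.segmentDrawing.exists_ne_seg_subset hF hO hd hu hk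
    (p := D.corner e c) (hck.imp (fun h => by rw [h]; rfl) (fun h => by rw [h]; rfl))
  have hmk : f = e → (m : ℕ) ≠ k := by
    rintro rfl h
    exact hne (by rw [Fin.ext h])
  rcases hpm with h | h
  · exact ⟨f, m, _, Or.inl rfl, h.symm, hm, hmk⟩
  · exact ⟨f, m, _, Or.inr rfl, h.symm, hm, hmk⟩

/-- If one segment of an edge separates `F` from `O`, then so does the whole edge. -/
lemma arc_subset_closure_inter_closure [Finite E(G)] (hF : IsOpen F) (hO : IsOpen O)
    (hd : Disjoint F O) (hu : F ∪ O = D.segmentDrawing.supportᶜ) {e : E(G)}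
    {k : Fin (D.segments e)} (hk : D.segmentDrawing.seg ⟨e, k⟩ ⊆ closure F ∩ closure O) :
    D.arc e ⊆ closure F ∩ closure O := by
  have hcorner : ∀ (l : Fin (D.segments e)) (c : ℕ), 0 < c → c < D.segments e →
      (c = l ∨ c = l + 1) → D.segmentDrawing.seg ⟨e, l⟩ ⊆ closure F ∩ closure O →
      ∃ m : Fin (D.segments e), m ≠ l ∧ (c = m ∨ c = m + 1) ∧
        D.segmentDrawing.seg ⟨e, m⟩ ⊆ closure F ∩ closure O := by
    intro l c hc0 hc hcl hl
    obtain ⟨f, m, c', hc', hcm, hm, hne⟩ := D.exists_seg_subset_of_corner hF hO hd hu hcl hl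
    have hc'f : c' ≤ D.segments f := by have := m.2; omega
    -- An inner corner is met by no other edge, so the separation continues within `e`, into the
    -- adjacent segment.
    obtain ⟨hfe, hcc⟩ := D.eq_of_polygonalCurve_eq (s := c) (t := c') e.2 f.2
      ⟨by exact_mod_cast hc0, by exact_mod_cast hc⟩
      ⟨by positivity, by exact_mod_cast hc'f⟩
      (by rw [polygonalCurve_natCast, polygonalCurve_natCast, hcm])
    obtain rfl : f = e := Subtype.ext hfe
    obtain rfl : c' = c := by exact_mod_cast hcc
    exact ⟨m, fun h => hne rfl (by rw [h]), hc', hm⟩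
  have hup : ∀ l (hl : l + 1 < D.segments e),
      D.segmentDrawing.seg ⟨e, ⟨l, by omega⟩⟩ ⊆ closure F ∩ closure O ↔
      D.segmentDrawing.seg ⟨e, ⟨l + 1, hl⟩⟩ ⊆ closure F ∩ closure O := by
    intro l hl
    constructor
    · intro h
      obtain ⟨m, hm, hcm, hs⟩ := hcorner ⟨l, by omega⟩ (l + 1) (by omega) hl (Or.inr rfl) h
      have : m = ⟨l + 1, hl⟩ := by
        rw [ne_eq, Fin.ext_iff] at hm
        simp only [Fin.ext_iff] at hm ⊢
        omega
      rwa [this] at hs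
    · intro h
      obtain ⟨m, hm, hcm, hs⟩ := hcorner ⟨l + 1, hl⟩ (l + 1) (by omega) hl (Or.inl rfl) h
      have : m = ⟨l, by omega⟩ := by
        rw [ne_eq, Fin.ext_iff] at hm
        simp only [Fin.ext_iff] at hm ⊢
        omega
      rwa [this] at hs
  have h0 : ∀ l (hl : l < D.segments e),
      D.segmentDrawing.seg ⟨e, ⟨l, hl⟩⟩ ⊆ closure F ∩ closure O ↔
      D.segmentDrawing.seg ⟨e, ⟨0, by omega⟩⟩ ⊆ closure F ∩ closure O := by
    intro l
    induction l with
    | zero => exact fun _ => Iff.rfl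
    | succ l ih => exact fun hl => (hup l hl).symm.trans (ih (by omega))
  rw [D.arc_eq e.2]
  exact iUnion_subset fun l => (h0 l l.2).2 ((h0 k k.2).1 hk)

lemma corner_eq_point {e : β} (he : e ∈ E(G)) {c : ℕ} (hc : c ≤ D.segments e) {y : α}
    (hy : y ∈ V(G)) (hp : D.corner e c = D.point y) :
    (c = 0 ∨ c = D.segments e) ∧ G.Inc e y := by
  have hc0 : c = 0 ∨ c = D.segments e := by
    by_contra! hne
    refine D.vertex_notMem e he y hy ⟨c, ⟨?_, ?_⟩, ?_⟩
    · exact_mod_cast Nat.pos_of_ne_zero hne.1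
    · exact_mod_cast lt_of_le_of_ne hc hne.2
    · rw [polygonalCurve_natCast, hp]
  refine ⟨hc0, ?_⟩
  obtain ⟨a, b, hab, ha, hb⟩ := D.ends e he
  rcases hc0 with rfl | rfl
  · rw [← D.point_injOn hab.left_mem hy (ha.symm.trans hp)]
    exact hab.inc_left
  · rw [← D.point_injOn hab.right_mem hy (hb.symm.trans hp)]
    exact hab.inc_right

/-- An edge both of whose ends are drawn at the same vertex is a loop. -/
lemma isLink_self_of_corner_eq {e : β} (he : e ∈ E(G)) {c c' : ℕ}
    (hc : c = 0 ∨ c = D.segments e) (hc' : c' = 0 ∨ c' = D.segments e) (hne : c ≠ c') {y : α}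
    (hy : y ∈ V(G)) (h : D.corner e c = D.point y) (h' : D.corner e c' = D.point y) :
    G.IsLink e y y := by
  obtain ⟨u, v, huv, hu, hv⟩ := D.ends e he
  have key : D.corner e 0 = D.point y → D.corner e (D.segments e) = D.point y →
      G.IsLink e y y := by
    intro h0 h1
    obtain rfl := D.point_injOn huv.left_mem hy (hu.symm.trans h0)
    obtain rfl := D.point_injOn huv.right_mem hy (hv.symm.trans h1)
    exact huv
  rcases hc with rfl | rfl <;> rcases hc' with rfl | rfl
  · exact absurd rfl hne
  · exact key h h'
  · exact key h' h
  · exact absurd rfl hne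

/-- If an edge separates `F` from `O`, then so does another edge at each of its ends, unless the
edge is a loop. -/
lemma exists_arc_subset_of_isLink [Finite E(G)] (hF : IsOpen F) (hO : IsOpen O)
    (hd : Disjoint F O) (hu : F ∪ O = D.segmentDrawing.supportᶜ) {e : β} {x y : α}
    (hl : G.IsLink e x y) (hs : D.arc e ⊆ closure F ∩ closure O) :
    ∃ f ∈ E(G), D.arc f ⊆ closure F ∩ closure O ∧ ∃ z, G.IsLink f y z ∧ (f ≠ e ∨ x = y) := by
  have he := hl.edge_mem
  have hpos := D.segments_pos e he
  have hseg : ∀ k : Fin (D.segments e), D.segmentDrawing.seg ⟨⟨e, he⟩, k⟩ ⊆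
      closure F ∩ closure O := fun k =>
    (subset_iUnion (fun k => D.segmentDrawing.seg ⟨⟨e, he⟩, k⟩) k).trans
      ((D.arc_eq he).symm.le.trans hs)
  obtain ⟨u, v, huv, hu0, hvn⟩ := D.ends e he
  obtain ⟨k, c, hck, hc, hcp⟩ : ∃ (k : Fin (D.segments e)) (c : ℕ), (c = k ∨ c = k + 1) ∧
      (c = 0 ∨ c = D.segments e) ∧ D.corner e c = D.point y := by
    rcases hl.right_eq_or_eq huv with rfl | rfl
    · exact ⟨⟨0, hpos⟩, 0, Or.inl rfl, Or.inl rfl, hu0⟩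
    · exact ⟨⟨D.segments e - 1, by omega⟩, D.segments e, Or.inr (by simp; omega), Or.inr rfl, hvn⟩
  obtain ⟨f, m, c', hcm, hc', hm, hne⟩ := D.exists_seg_subset_of_corner hF hO hd hu hck (hseg k)
  rw [hcp] at hc'
  have hm2 := m.2
  obtain ⟨hc'0, z, hz⟩ := D.corner_eq_point f.2 (by omega) hl.right_mem hc'
  refine ⟨f, f.2, D.arc_subset_closure_inter_closure hF hO hd hu hm, z, hz, ?_⟩
  by_cases hfe : (f : β) = e
  · right
    obtain rfl : f = ⟨e, he⟩ := Subtype.ext hfe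
    have hmk := hne rfl
    have hk2 := k.2
    -- Each end number belongs to a single segment of `e`. A different segment thus reaches `y` at
    -- the other end, and `e` is a loop.
    have hcc : c ≠ c' := by
      dsimp only at hm2 hk2 hc'0
      omega
    exact hl.left_unique (D.isLink_self_of_corner_eq he hc hc'0 hcc hl.right_mem hcp hc')
  · exact Or.inl hfe

end Separation

/-! ### The small face and its cycle -/

/-- The boundary of a face that is not the only one contains the edges of a cycle. -/
lemma exists_isCycle_boundaryEdges (hV : V(G).Finite) (hE : E(G).Finite) {F : Set (ℝ × ℝ)}
    (hF : F ∈ D.segmentDrawing.faces) (hne : (D.segmentDrawing.supportᶜ \ F).Nonempty) :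
    ∃ (n : ℕ) (v : Fin n → α) (e : Fin n → β),
      G.IsCycle n v e ∧ ∀ i, e i ∈ D.boundaryEdges F := by
  have := hE.to_subtype
  set S := D.segmentDrawing
  have hFo := S.isOpen_of_mem_faces hF
  have hOo := S.isOpen_compl_support_diff_face hF
  have hd : Disjoint F (S.supportᶜ \ F) := disjoint_sdiff_right
  have hu : F ∪ (S.supportᶜ \ F) = S.supportᶜ :=
    union_sdiff_cancel (S.subset_compl_support_of_mem_faces hF)
  have hFne : F.Nonempty := by
    obtain ⟨q, hq, rfl⟩ := hF
    exact ⟨q, mem_connectedComponentIn hq⟩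
  have hJ : closure F ∩ closure (S.supportᶜ \ F) ⊆ frontier F := fun q hq =>
    ⟨hq.1, fun h => disjoint_left.1 (hd.closure_right hFo) (interior_subset h) hq.2⟩
  obtain ⟨⟨e₀, k⟩, hk⟩ := S.exists_seg_subset hFo hOo hd hu hFne hne
  have he₀ := D.arc_subset_closure_inter_closure hFo hOo hd hu hk
  obtain ⟨x₀, y₀, hl₀⟩ := exists_isLink_of_mem_edgeSet e₀.2
  obtain ⟨n, v, e, hc, he⟩ := exists_isCycle_of_forall_continued hV
    -- Only separating edges are used: an edge with `F` on both sides also lies on the frontier, but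
    -- may lead to a dead end.
    (K := {e | e ∈ E(G) ∧ D.arc e ⊆ closure F ∩ closure (S.supportᶜ \ F)}) ⟨e₀.2, he₀⟩ hl₀
    (fun e he x y hl => by
      obtain ⟨f, hf, hfs, z, hz⟩ := D.exists_arc_subset_of_isLink hFo hOo hd hu hl he.2
      exact ⟨f, ⟨hf, hfs⟩, z, hz⟩)
  exact ⟨n, v, e, hc, fun i => ⟨(he i).1, (he i).2.trans hJ⟩⟩

/-- A plane drawing of a cubic graph has a face with at most five edges on its boundary, among
which there are the edges of a cycle. -/
lemma exists_face_encard_le_five (hG : G.IsCubic) (hV : V(G).Finite) (hne : V(G).Nonempty) :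
    ∃ F ∈ D.faces, (D.boundaryEdges F).encard ≤ 5 ∧
      ∃ (n : ℕ) (v : Fin n → α) (e : Fin n → β),
        G.IsCycle n v e ∧ n ≤ 5 ∧ ∀ i, e i ∈ D.boundaryEdges F := by
  have hE := hG.finite_edgeSet hV
  have hshake := hG.three_mul_ncard_le hV
  have hVpos : 0 < V(G).ncard := (Set.ncard_pos hV).2 hne
  have hinc : ∀ x ∈ V(G), ∃ e, G.Inc e x := by
    intro x hx
    by_contra! hno
    have h1 : G.incidenceSet x = ∅ := eq_empty_of_forall_notMem hno
    have h2 : G.loopSet x = ∅ := eq_empty_of_forall_notMem fun e he => hno e he.inc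
    simpa [h1, h2] using hG x hx
  rw [D.faces_eq hinc]
  obtain ⟨F, hF, h5⟩ : ∃ F ∈ D.segmentDrawing.faces, (D.boundaryEdges F).encard ≤ 5 := by
    by_contra! hbig
    -- Counting over arbitrary finite sets of faces also yields that there are finitely many faces.
    have hT : ∀ T : Finset (Set (ℝ × ℝ)), ↑T ⊆ D.segmentDrawing.faces →
        T.card * 6 ≤ E(G).ncard * 2 := fun T hT =>
      D.six_mul_card_le hE (fun F hF => hT hF) fun F hF => (hbig F (hT hF)).not_ge
    have hfin : D.segmentDrawing.faces.Finite := by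
      by_contra hinf
      obtain ⟨T, hTs, hTc⟩ := Set.Infinite.exists_subset_card_eq hinf (E(G).ncard + 1)
      have := hT T hTs
      omega
    have h6 := hT hfin.toFinset (by simp)
    rw [← Set.ncard_eq_toFinset_card _ hfin] at h6
    have := D.ncard_edgeSet_lt_ncard_faces_add hV hE hfin
    omega
  refine ⟨F, hF, h5, ?_⟩
  -- With a single face, Euler's inequality would give e ≤ v, against 3v ≤ 2e and v > 0.
  have hne : (D.segmentDrawing.supportᶜ \ F).Nonempty := by
    by_contra hempty
    rw [not_nonempty_iff_eq_empty, sdiff_eq_empty] at hempty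
    have hsub : D.segmentDrawing.faces ⊆ {F} := by
      intro F' hF'
      obtain ⟨q, hq, rfl⟩ := hF'
      exact (D.segmentDrawing.eq_connectedComponentIn_of_mem_faces hF (hempty hq)).symm
    have hcard := Set.ncard_le_ncard hsub (finite_singleton F)
    rw [Set.ncard_singleton] at hcard
    have := D.ncard_edgeSet_lt_ncard_faces_add hV hE ((finite_singleton F).subset hsub)
    omega
  obtain ⟨n, v, e, hc, he⟩ := D.exists_isCycle_boundaryEdges hV hE hF hne
  refine ⟨n, v, e, hc, ?_, he⟩
  have := hc.edge_injective.encard_range.trans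
    ((Set.encard_le_encard (range_subset_iff.2 he)).trans h5)
  simpa using this

end PlaneDrawing

end Graph

theorem lemma1 {α β : Type*} (G : Graph α β) (hfin : V(G).Finite) (hne : V(G).Nonempty)
    (hcubic : G.IsCubic) (hbridgeless : G.IsBridgeless) (hplanar : G.IsPlanar) :
    G.egirth ≤ 5 ∧
    ∀ D : G.PlaneDrawing, ∃ F ∈ D.faces, (D.boundaryEdges F).encard ≤ 5 ∧
      ∃ (n : ℕ) (v : Fin n → α) (e : Fin n → β),
        G.IsCycle n v e ∧ n ≤ 5 ∧ ∀ i, e i ∈ D.boundaryEdges F := by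
  have h := fun D : G.PlaneDrawing => D.exists_face_encard_le_five hcubic hfin hne
  refine ⟨?_, h⟩
  obtain ⟨F, -, -, n, v, e, hc, hn, -⟩ := h hplanar.some
  exact (iInf₂_le n ⟨v, e, hc⟩).trans (by exact_mod_cast hn)
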